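/- Let $F$ be a field of characteristic different from $2$, let $W(F)$ be its Witt ring of finite-dimensional non-degenerate quadratic forms, let $IF\subseteq W(F)$ be the fundamental ideal of classes of even-dimensional forms, and let $I^kF=(IF)^k$. For $a_1,\dots,a_n\in F^\ast$ write $\langle\langle a_1,\dots,a_n\rangle\rangle=\langle 1,a_1\rangle\otimes\cdots\otimes\langle 1,a_n\rangle$; up to isometry this depends only on the square classes of the $a_i$. For $m\ge 0$ let $D_F(2^m)$ be the group of non-zero sums of $2^m$ squares in $F$, and let $\pm D_F(2^m)=D_F(2^m)\cup -D_F(2^m)$. Regard $F^\ast/F^{\ast2}$ as a vector space over $\mathbb F_2$. Let $\mathcal A_0\subseteq\mathcal A_1\subseteq\mathcal A_2\subseteq\cdots$ be subsets of $F^\ast/F^{\ast2}$ such that $\mathcal A_m$ is a basis of $\pm D_F(2^m)/F^{\ast2}$ for every $m\geq 0$, let $\mathcal B$ be a basis of $F^\ast/F^{\ast2}$ that contains $\bigcup_{m\ge 0}\mathcal A_m$, and put $\mathcal B_m=\mathcal B\setminus\mathcal A_m$ (the classes of the elements of $\mathcal B_m$ form a basis of $F^\ast/\pm D_F(2^m)$).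 For a finite set $U=\{u_1,\dots,u_r\}\subseteq\mathcal B$ of $r$ square classes and $k\ge 0$ write $$\pi_{U,k}=\langle\langle \underbrace{1,\dots,1}_{k},u_1,\dots,u_r\rangle\rangle .$$ Let $n\ge 0$ be an integer and $\varphi\in I^nF$. Then for every $m\in\{0,\dots,n\}$ there is a finite set $C_m$ of $m$-element subsets of $\mathcal B_{n-m}$ such that $$\varphi\equiv\sum_{m=0}^n\ \sum_{U\in C_m}\pi_{U,n-m}\pmod{I^{n+1}F}.$$ -/

import Mathlib

open scoped TensorProduct

namespace QForm

universe u v w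

set_option linter.unusedSectionVars false

section Nondegenerate

variable {F : Type u} [Field F] [Invertible (2 : F)]
variable {V : Type v} [AddCommGroup V] [Module F V] {W : Type w} [AddCommGroup W] [Module F W]

theorem nondegenerate_iff (Q : QuadraticForm F V) :
    Q.Nondegenerate ↔ ∀ x, (∀ y, QuadraticMap.associated Q x y = 0) → x = 0 := by
  rw [← QuadraticMap.nondegenerate_associated_iff,
    LinearMap.IsRefl.nondegenerate_iff_separatingLeft]
  · rfl
  · exact fun x y => (congr_arg (· x y) (QuadraticMap.associated_flip F Q)).trans

theorem nondegenerate_of_equivalent {Q : QuadraticForm F V} {Q' : QuadraticForm F W}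
    (h : Q.Equivalent Q') (hQ : Q.Nondegenerate) : Q'.Nondegenerate := by
  obtain ⟨e⟩ := h
  rw [nondegenerate_iff] at hQ ⊢
  intro x hx
  have h1 : ∀ a b, QuadraticMap.associated Q a b = QuadraticMap.associated Q' (e a) (e b) := by
    intro a b
    simp only [QuadraticMap.associated_apply]
    rw [← map_add e, e.map_app, e.map_app, e.map_app]
  have h2 : e.symm x = 0 := hQ _ fun y => by
    rw [h1]
    simpa using hx (e y)
  have h3 := congrArg e h2
  simpa using h3

theorem nondegenerate_prod {Q : QuadraticForm F V} {Q' : QuadraticForm F W}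
    (hQ : Q.Nondegenerate) (hQ' : Q'.Nondegenerate) : (Q.prod Q').Nondegenerate := by
  rw [nondegenerate_iff] at hQ hQ' ⊢
  rintro ⟨x, x'⟩ h
  have h1 : x = 0 := hQ x fun y => by simpa using h (y, 0)
  have h2 : x' = 0 := hQ' x' fun y => by simpa using h (0, y)
  simp [h1, h2]

theorem nondegenerate_tmul [FiniteDimensional F V] [FiniteDimensional F W]
    {Q : QuadraticForm F V} {Q' : QuadraticForm F W}
    (hQ : Q.Nondegenerate) (hQ' : Q'.Nondegenerate) :
    (QuadraticForm.tmul Q Q').Nondegenerate := by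
  rw [nondegenerate_iff] at hQ hQ' ⊢
  set B := QuadraticMap.associated Q
  set B' := QuadraticMap.associated Q'
  have i1 : Function.Injective (B : V →ₗ[F] Module.Dual F V) := by
    rw [injective_iff_map_eq_zero]
    exact fun x hx => hQ x fun y => by rw [hx]; rfl
  have i2 : Function.Injective (B' : W →ₗ[F] Module.Dual F W) := by
    rw [injective_iff_map_eq_zero]
    exact fun x hx => hQ' x fun y => by rw [hx]; rfl
  have i3 : Function.Injective (TensorProduct.map (B : V →ₗ[F] Module.Dual F V)
      (B' : W →ₗ[F] Module.Dual F W)) := TensorProduct.map_injective_of_flat_flat _ _ i1 i2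
  have i4 := (TensorProduct.dualDistribEquiv F V W).injective.comp i3
  have h : ∀ x y, QuadraticMap.associated (QuadraticForm.tmul Q Q') x y =
      TensorProduct.dualDistribEquiv F V W (TensorProduct.map (B : V →ₗ[F] Module.Dual F V)
      (B' : W →ₗ[F] Module.Dual F W) x) y := by
    intro x y
    rw [QuadraticForm.associated_tmul]
    induction x with
    | zero => simp
    | add a b ha hb => simp only [map_add, LinearMap.add_apply, ha, hb]
    | tmul a b =>
      induction y with
      | zero => simp
      | add c d hc hd => simp only [map_add, hc, hd]
      | tmul c d =>
        simp [TensorProduct.dualDistribEquiv, TensorProduct.dualDistribEquivOfBasis, B, B',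
          mul_comm]
  intro x hx
  apply i4
  simp only [Function.comp_apply, map_zero]
  ext1
  ext a b
  simpa using (h x (a ⊗ₜ b)).symm.trans (hx _)

theorem nondegenerate_smul_sq (a : Fˣ) :
    ((a : F) • (QuadraticMap.sq : QuadraticForm F F)).Nondegenerate := by
  rw [nondegenerate_iff]
  intro x hx
  simpa using hx 1

theorem nondegenerate_zero [Subsingleton V] : (0 : QuadraticForm F V).Nondegenerate := by
  rw [nondegenerate_iff]
  exact fun x _ => Subsingleton.elim _ _

end Nondegenerate


section IsometryClasses

variable (F : Type u) [Field F]

/-- A finite dimensional non-degenerate quadratic form over `F`, in coordinates. -/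
structure Form where
  dim : ℕ
  form : QuadraticForm F (Fin dim → F)
  nondegenerate : form.Nondegenerate

instance formSetoid : Setoid (Form F) where
  r q q' := q.form.Equivalent q'.form
  iseqv := ⟨fun q => .refl q.form, fun h => h.symm, fun h h' => h.trans h'⟩

/-- Isometry classes of finite dimensional non-degenerate quadratic forms over `F`. -/
def FormClass : Type u := Quotient (formSetoid F)

namespace FormClass

variable {F} [Invertible (2 : F)]
variable {V : Type v} [AddCommGroup V] [Module F V] [FiniteDimensional F V]
variable {W : Type w} [AddCommGroup W] [Module F W] [FiniteDimensional F W]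

theorem equivalent_coord (Q : QuadraticForm F V) :
    Q.Equivalent (Q.basisRepr (Module.finBasis F V)) :=
  ⟨Q.isometryEquivBasisRepr _⟩

/-- The isometry class of a non-degenerate quadratic form on a finite dimensional space. -/
noncomputable def mk (Q : QuadraticForm F V) (hQ : Q.Nondegenerate) : FormClass F :=
  Quotient.mk (formSetoid F)
    ⟨Module.finrank F V, Q.basisRepr (Module.finBasis F V),
      nondegenerate_of_equivalent (equivalent_coord Q) hQ⟩

theorem mk_eq_mk {Q : QuadraticForm F V} {hQ : Q.Nondegenerate} {Q' : QuadraticForm F W}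
    {hQ' : Q'.Nondegenerate} : mk Q hQ = mk Q' hQ' ↔ Q.Equivalent Q' := by
  constructor
  · intro h
    have h' : (Q.basisRepr (Module.finBasis F V)).Equivalent
      (Q'.basisRepr (Module.finBasis F W)) := Quotient.exact h
    exact (equivalent_coord Q).trans (h'.trans (equivalent_coord Q').symm)
  · exact fun h => Quotient.sound (s := formSetoid F)
      ((equivalent_coord Q).symm.trans (h.trans (equivalent_coord Q')))

theorem sound {Q : QuadraticForm F V} {hQ : Q.Nondegenerate} {Q' : QuadraticForm F W}
    {hQ' : Q'.Nondegenerate} (e : Q.IsometryEquiv Q') : mk Q hQ = mk Q' hQ' :=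
  mk_eq_mk.2 ⟨e⟩

theorem exists_rep (q : FormClass F) : ∃ (n : ℕ) (Q : QuadraticForm F (Fin n → F))
    (hQ : Q.Nondegenerate), q = mk Q hQ := by
  induction q using Quotient.inductionOn with
  | h a => exact ⟨a.dim, a.form, a.nondegenerate,
      Quotient.sound (s := formSetoid F) (equivalent_coord a.form)⟩

/-- The sum of isometry classes is given by the orthogonal sum of forms. -/
noncomputable instance : Add (FormClass F) where
  add := Quotient.lift₂
    (fun a b => mk (a.form.prod b.form) (nondegenerate_prod a.nondegenerate b.nondegenerate))
    fun _ _ _ _ h h' => mk_eq_mk.2 (h.prod h')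

theorem tmul_equivalent {V' : Type*} [AddCommGroup V'] [Module F V'] {W' : Type*}
    [AddCommGroup W'] [Module F W'] {Q : QuadraticForm F V} {Q' : QuadraticForm F V'}
    {R : QuadraticForm F W} {R' : QuadraticForm F W'}
    (h : Q.Equivalent Q') (h' : R.Equivalent R') :
    (QuadraticForm.tmul Q R).Equivalent (QuadraticForm.tmul Q' R') := by
  obtain ⟨e⟩ := h
  obtain ⟨e'⟩ := h'
  exact ⟨{ TensorProduct.congr e.toLinearEquiv e'.toLinearEquiv with
    map_app' := fun x => QuadraticForm.tmul_tensorMap_apply e.toIsometry e'.toIsometry x }⟩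

/-- The product of isometry classes is given by the tensor product of forms. -/
noncomputable instance : Mul (FormClass F) where
  mul := Quotient.lift₂
    (fun a b => mk (QuadraticForm.tmul a.form b.form)
      (nondegenerate_tmul a.nondegenerate b.nondegenerate))
    fun _ _ _ _ h h' => mk_eq_mk.2 (tmul_equivalent h h')

theorem mk_add_mk (Q : QuadraticForm F V) (hQ : Q.Nondegenerate) (Q' : QuadraticForm F W)
    (hQ' : Q'.Nondegenerate) : mk Q hQ + mk Q' hQ' = mk (Q.prod Q') (nondegenerate_prod hQ hQ') :=
  mk_eq_mk (hQ := nondegenerate_prod (nondegenerate_of_equivalent (equivalent_coord Q) hQ)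
    (nondegenerate_of_equivalent (equivalent_coord Q') hQ')) |>.2
    ((equivalent_coord Q).prod (equivalent_coord Q')).symm

theorem mk_mul_mk (Q : QuadraticForm F V) (hQ : Q.Nondegenerate) (Q' : QuadraticForm F W)
    (hQ' : Q'.Nondegenerate) :
    mk Q hQ * mk Q' hQ' = mk (QuadraticForm.tmul Q Q') (nondegenerate_tmul hQ hQ') :=
  mk_eq_mk (hQ := nondegenerate_tmul (nondegenerate_of_equivalent (equivalent_coord Q) hQ)
    (nondegenerate_of_equivalent (equivalent_coord Q') hQ')) |>.2
    (tmul_equivalent (equivalent_coord Q) (equivalent_coord Q')).symm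

/-- The class of the zero-dimensional form. -/
noncomputable instance : Zero (FormClass F) where
  zero := mk (0 : QuadraticForm F (Fin 0 → F)) nondegenerate_zero

/-- The isometry class of the one-dimensional form `⟨a⟩`, that is `x ↦ a * x ^ 2`. -/
noncomputable def diag (a : Fˣ) : FormClass F :=
  mk ((a : F) • (QuadraticMap.sq : QuadraticForm F F)) (nondegenerate_smul_sq a)

theorem nondegenerate_sq : (QuadraticMap.sq : QuadraticForm F F).Nondegenerate := by
  simpa using nondegenerate_smul_sq (1 : Fˣ)

/-- The class of the form `⟨1⟩`. -/
noncomputable instance : One (FormClass F) where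
  one := mk QuadraticMap.sq nondegenerate_sq

theorem diag_one : diag (1 : Fˣ) = 1 := mk_eq_mk.2 (by simpa using .refl _)

theorem zero_eq_mk [Subsingleton V] {Q : QuadraticForm F V} (hQ : Q.Nondegenerate) :
    (0 : FormClass F) = mk Q hQ :=
  mk_eq_mk.2 ⟨{ (0 : (Fin 0 → F) ≃ₗ[F] V) with
    map_app' := fun x => by simp }⟩

protected theorem add_comm' (a b : FormClass F) : a + b = b + a := by
  obtain ⟨_, Q, hQ, rfl⟩ := exists_rep a
  obtain ⟨_, Q', hQ', rfl⟩ := exists_rep b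
  rw [mk_add_mk, mk_add_mk]
  exact sound (.prodComm _ _)

protected theorem mul_comm' (a b : FormClass F) : a * b = b * a := by
  obtain ⟨_, Q, hQ, rfl⟩ := exists_rep a
  obtain ⟨_, Q', hQ', rfl⟩ := exists_rep b
  rw [mk_mul_mk, mk_mul_mk]
  exact sound (QuadraticForm.tensorComm _ _)

protected theorem zero_add' (a : FormClass F) : 0 + a = a := by
  obtain ⟨_, Q, hQ, rfl⟩ := exists_rep a
  refine (mk_add_mk _ _ _ _).trans (sound
    { LinearEquiv.uniqueProd (R := F) with map_app' := fun x => ?_ })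
  simp [LinearEquiv.uniqueProd]

protected theorem zero_mul' (a : FormClass F) : 0 * a = 0 := by
  obtain ⟨_, Q, hQ, rfl⟩ := exists_rep a
  refine (mk_mul_mk _ _ _ _).trans (zero_eq_mk _).symm

protected theorem one_mul' (a : FormClass F) : 1 * a = a := by
  obtain ⟨_, Q, hQ, rfl⟩ := exists_rep a
  exact (mk_mul_mk _ _ _ _).trans (sound (QuadraticForm.tensorLId _))

theorem left_distrib' (a b c : FormClass F) : a * (b + c) = a * b + a * c := by
  obtain ⟨_, Q, hQ, rfl⟩ := exists_rep a
  obtain ⟨_, Q', hQ', rfl⟩ := exists_rep b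
  obtain ⟨_, Q'', hQ'', rfl⟩ := exists_rep c
  simp only [mk_mul_mk, mk_add_mk]
  refine sound { TensorProduct.prodRight F F _ _ _ with map_app' := fun x => ?_ }
  have key : ((QuadraticForm.tmul Q Q').prod (QuadraticForm.tmul Q Q'')).comp
      (TensorProduct.prodRight F F _ _ _).toLinearMap = QuadraticForm.tmul Q (Q'.prod Q'') := by
    refine (QuadraticMap.associated_rightInverse F).injective ?_
    ext <;> simp [QuadraticForm.associated_tmul, QuadraticMap.associated_comp]
  exact DFunLike.congr_fun key x

noncomputable instance : CommSemiring (FormClass F) where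
  add_assoc a b c := by
    obtain ⟨_, Q, hQ, rfl⟩ := exists_rep a
    obtain ⟨_, Q', hQ', rfl⟩ := exists_rep b
    obtain ⟨_, Q'', hQ'', rfl⟩ := exists_rep c
    simp only [mk_add_mk]
    exact sound { LinearEquiv.prodAssoc F _ _ _ with map_app' := fun x => by simp [add_assoc] }
  zero_add := FormClass.zero_add'
  add_zero a := by rw [FormClass.add_comm', FormClass.zero_add']
  nsmul := nsmulRec
  add_comm := FormClass.add_comm'
  left_distrib := left_distrib'
  right_distrib a b c := by
    rw [FormClass.mul_comm', left_distrib', FormClass.mul_comm' c a,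
      FormClass.mul_comm' c b]
  zero_mul := FormClass.zero_mul'
  mul_zero a := by rw [FormClass.mul_comm', FormClass.zero_mul']
  mul_assoc a b c := by
    obtain ⟨_, Q, hQ, rfl⟩ := exists_rep a
    obtain ⟨_, Q', hQ', rfl⟩ := exists_rep b
    obtain ⟨_, Q'', hQ'', rfl⟩ := exists_rep c
    simp only [mk_mul_mk]
    exact sound (QuadraticForm.tensorAssoc _ _ _)
  one_mul := FormClass.one_mul'
  mul_one a := by rw [FormClass.mul_comm', FormClass.one_mul']
  mul_comm := FormClass.mul_comm'


/-- The dimension of an isometry class, as a homomorphism of semirings. -/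
noncomputable def dim : FormClass F →+* ℕ where
  toFun := Quotient.lift (fun a => a.dim) fun a b h => by
    obtain ⟨e⟩ := h
    simpa using e.toLinearEquiv.finrank_eq
  map_one' := Module.finrank_self F
  map_zero' := Module.finrank_fin_fun F
  map_add' := by
    rintro ⟨a⟩ ⟨b⟩
    exact (Module.finrank_prod).trans (by simp)
  map_mul' := by
    rintro ⟨a⟩ ⟨b⟩
    exact (Module.finrank_tensorProduct).trans (by simp)

theorem diag_mul_diag (a b : Fˣ) : diag a * diag b = diag (a * b) := by
  refine (mk_mul_mk _ _ _ _).trans (sound { TensorProduct.lid F F with map_app' := fun x => ?_ })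
  have key : (((a * b : Fˣ) : F) • (QuadraticMap.sq : QuadraticForm F F)).comp
      (TensorProduct.lid F F).toLinearMap =
      QuadraticForm.tmul ((a : F) • (QuadraticMap.sq : QuadraticForm F F))
        ((b : F) • (QuadraticMap.sq : QuadraticForm F F)) := by
    refine (QuadraticMap.associated_rightInverse F).injective ?_
    ext
    simp [QuadraticForm.associated_tmul, QuadraticMap.associated_comp, mul_comm]
  exact DFunLike.congr_fun key x

theorem diag_mul_sq (a c : Fˣ) : diag (a * (c * c)) = diag a := by
  refine sound { LinearEquiv.smulOfUnit c with map_app' := fun x => ?_ }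
  simp [LinearEquiv.smulOfUnit, Units.smul_def]
  ring

/-- Binary diagonal forms that are related by an invertible substitution are isometric. -/
theorem diag_add_diag_eq {a b c d : Fˣ} (p q r s : F) (hdet : p * s - q * r ≠ 0)
    (h1 : (a : F) * p ^ 2 + b * r ^ 2 = c) (h2 : (a : F) * q ^ 2 + b * s ^ 2 = d)
    (h3 : (a : F) * p * q + b * r * s = 0) : diag a + diag b = diag c + diag d := by
  have hinv := mul_inv_cancel₀ hdet
  refine ((mk_add_mk _ _ _ _).trans ((sound ?_).trans (mk_add_mk _ _ _ _).symm))
  refine QuadraticMap.IsometryEquiv.symm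
    { toFun := fun x => (p * x.1 + q * x.2, r * x.1 + s * x.2)
      invFun := fun x => ((p * s - q * r)⁻¹ * (s * x.1 - q * x.2),
        (p * s - q * r)⁻¹ * (p * x.2 - r * x.1))
      map_add' := fun x y => by ext <;> simp <;> ring
      map_smul' := fun t x => by ext <;> simp <;> ring
      left_inv := fun x => by
        ext
        · simp only
          linear_combination x.1 * hinv
        · simp only
          linear_combination x.2 * hinv
      right_inv := fun x => by
        ext
        · simp only
          linear_combination x.1 * hinv
        · simp only
          linear_combination x.2 * hinv
      map_app' := fun x => ?_ }
  simp [← h1, ← h2]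
  linear_combination (2 * x.1 * x.2) * h3

/-- The hyperbolic plane `⟨1, -1⟩`. -/
noncomputable def hyperbolicPlane : FormClass F := 1 + diag (-1)

theorem diag_mul_hyperbolicPlane (a : Fˣ) : diag a * hyperbolicPlane = hyperbolicPlane := by
  rw [hyperbolicPlane, mul_add, mul_one, diag_mul_diag, ← diag_one]
  have h2 : (2 : F) ≠ 0 := Invertible.ne_zero 2
  refine (diag_add_diag_eq (((a : F) + 1) / 2) ((a - 1) / 2) ((a - 1) / 2) ((a + 1) / 2)
    ?_ ?_ ?_ ?_).symm
  · have h : ((a : F) + 1) / 2 * ((a + 1) / 2) - (a - 1) / 2 * ((a - 1) / 2) = a := by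
      field_simp
      ring
    rw [h]
    exact a.ne_zero
  · simp
    field_simp
    ring
  · simp
    field_simp
    ring
  · simp
    ring

theorem exists_sum_diag (q : FormClass F) : ∃ s : Multiset Fˣ, q = (s.map diag).sum := by
  obtain ⟨n, Q, hQ, rfl⟩ := exists_rep q
  obtain ⟨w, hw⟩ := QuadraticForm.equivalent_weightedSumSquares_units_of_nondegenerate' Q
    ((nondegenerate_iff Q).1 hQ)
  have main : ∀ (k : ℕ) (w : Fin k → Fˣ)
      (h : (QuadraticMap.weightedSumSquares F w).Nondegenerate),
      mk (QuadraticMap.weightedSumSquares F w) h = ∑ i, diag (w i) := by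
    intro k
    induction k with
    | zero => exact fun w h => by simpa using (zero_eq_mk h).symm
    | succ k ih =>
      intro w h
      have e : (QuadraticMap.prod ((w 0 : F) • (QuadraticMap.sq : QuadraticForm F F))
          (QuadraticMap.weightedSumSquares F (Fin.tail w))).IsometryEquiv
          (QuadraticMap.weightedSumSquares F w) :=
        { Fin.consLinearEquiv F (fun _ => F) with
          map_app' := fun x => by
            simp [QuadraticMap.weightedSumSquares_apply, Fin.sum_univ_succ,
              Units.smul_def, Fin.consLinearEquiv, Fin.tail] }
      have hn : (QuadraticMap.weightedSumSquares F (Fin.tail w)).Nondegenerate := by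
        have h' := nondegenerate_of_equivalent ⟨e.symm⟩ h
        rw [nondegenerate_iff] at h' ⊢
        intro x hx
        have := h' (0, x) fun y => by simpa using hx y.2
        simpa using this
      rw [Fin.sum_univ_succ]
      exact (sound e).symm.trans ((mk_add_mk _ (nondegenerate_smul_sq _) _ hn).symm.trans
        (congrArg _ (ih _ hn)))
  refine ⟨Finset.univ.val.map w, ?_⟩
  rw [Multiset.map_map]
  exact (mk_eq_mk.2 hw).trans (main _ w (nondegenerate_of_equivalent hw hQ))

theorem mul_hyperbolicPlane (q : FormClass F) :
    q * hyperbolicPlane = dim q • hyperbolicPlane := by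
  obtain ⟨s, rfl⟩ := exists_sum_diag q
  induction s using Multiset.induction_on with
  | empty => simp
  | cons a s ih =>
    have h1 : dim (diag a) = 1 := Module.finrank_self F
    simp only [Multiset.map_cons, Multiset.sum_cons, add_mul, diag_mul_hyperbolicPlane, ih,
      map_add, add_smul, h1, one_smul]


theorem mk_sumSquares (n : ℕ)
    (h : (QuadraticMap.weightedSumSquares F (1 : Fin n → F)).Nondegenerate) :
    mk (QuadraticMap.weightedSumSquares F (1 : Fin n → F)) h = n := by
  induction n with
  | zero => simpa using (zero_eq_mk h).symm
  | succ k ih =>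
    have e : (QuadraticMap.prod (QuadraticMap.sq : QuadraticForm F F)
        (QuadraticMap.weightedSumSquares F (1 : Fin k → F))).IsometryEquiv
        (QuadraticMap.weightedSumSquares F (1 : Fin (k + 1) → F)) :=
      { Fin.consLinearEquiv F (fun _ => F) with
        map_app' := fun x => by
          simp [QuadraticMap.weightedSumSquares_apply, Fin.sum_univ_succ, Fin.consLinearEquiv] }
    have hn : (QuadraticMap.weightedSumSquares F (1 : Fin k → F)).Nondegenerate := by
      have h' := nondegenerate_of_equivalent ⟨e.symm⟩ h
      rw [nondegenerate_iff] at h' ⊢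
      intro x hx
      have := h' (0, x) fun y => by simpa using hx y.2
      simpa using this
    rw [Nat.cast_succ, add_comm (k : FormClass F)]
    exact (sound e).symm.trans ((mk_add_mk _ nondegenerate_sq _ hn).symm.trans
      (congrArg _ (ih hn)))

theorem nondegenerate_sumSquares (n : ℕ) :
    (QuadraticMap.weightedSumSquares F (1 : Fin n → F)).Nondegenerate := by
  rw [nondegenerate_iff]
  intro x hx
  ext i
  have h := hx (Pi.single i 1)
  have h2 : (2 : F) ≠ 0 := Invertible.ne_zero 2
  rw [QuadraticMap.associated_apply] at h
  have h3 : ∀ j, (x + Pi.single i 1 : Fin n → F) j * (x + Pi.single i 1 : Fin n → F) j - x j * x j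
      - (Pi.single i 1 : Fin n → F) j * (Pi.single i 1 : Fin n → F) j
      = 2 * (x j * (Pi.single i 1 : Fin n → F) j) := fun j => by simp; ring
  simp only [QuadraticMap.weightedSumSquares_apply, Pi.one_apply, one_smul,
    ← Finset.sum_sub_distrib, h3, ← Finset.mul_sum] at h
  simpa [Pi.single_apply, h2] using h

end FormClass

end IsometryClasses

section SumsOfSquares

variable {F : Type u} [Field F]

/-- `IsSumSqs n d`: `d` is a sum of `n` squares in `F`, i.e. is represented by `n × ⟨1⟩`. -/
def IsSumSqs (n : ℕ) (d : F) : Prop := ∃ x : Fin n → F, d = ∑ i, x i ^ 2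

theorem isSumSqs_add {k l : ℕ} {d : F} :
    IsSumSqs (k + l) d ↔ ∃ a b, IsSumSqs k a ∧ IsSumSqs l b ∧ d = a + b := by
  constructor
  · rintro ⟨x, rfl⟩
    exact ⟨_, _, ⟨fun i => x (Fin.castAdd l i), rfl⟩, ⟨fun i => x (Fin.natAdd k i), rfl⟩,
      Fin.sum_univ_add _⟩
  · rintro ⟨_, _, ⟨x, rfl⟩, ⟨y, rfl⟩, rfl⟩
    exact ⟨Fin.append x y, by simp [Fin.sum_univ_add]⟩

variable [Invertible (2 : F)]

open FormClass in
/-- The form `2 ^ m × ⟨1⟩` is round. -/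
theorem diag_mul_two_pow (m : ℕ) (d : Fˣ) (hd : IsSumSqs (2 ^ m) (d : F)) :
    diag d * ((2 ^ m : ℕ) : FormClass F) = ((2 ^ m : ℕ) : FormClass F) := by
  induction m generalizing d with
  | zero =>
    obtain ⟨x, hx⟩ := hd
    have hx' : (d : F) = x 0 ^ 2 := by simpa using hx
    have hx0 : x 0 ≠ 0 := fun h => d.ne_zero (by simp [hx', h])
    have : d = 1 * (Units.mk0 _ hx0 * Units.mk0 _ hx0) := by
      ext
      simp [hx', sq]
    rw [this, diag_mul_sq, diag_one, one_mul]
  | succ m ih =>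
    have e : ((2 ^ (m + 1) : ℕ) : FormClass F) = (1 + 1) * ((2 ^ m : ℕ) : FormClass F) := by
      push_cast
      rw [pow_succ, ← one_add_one_eq_two, mul_comm]
    obtain ⟨a, b, ha, hb, hab⟩ := (isSumSqs_add (k := 2 ^ m) (l := 2 ^ m)).1
      (by rwa [← two_mul, ← pow_succ'])
    rw [e]
    by_cases ha0 : a = 0
    · have h := ih d (by rwa [hab, ha0, zero_add])
      rw [mul_left_comm, h]
    by_cases hb0 : b = 0
    · have h := ih d (by rwa [hab, hb0, add_zero])
      rw [mul_left_comm, h]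
    lift a to Fˣ using IsUnit.mk0 a ha0
    lift b to Fˣ using IsUnit.mk0 b hb0
    have hA := ih a ha
    have hB := ih b hb
    have h1 : diag a + diag b = diag d + diag (d * (a * b)) := by
      refine diag_add_diag_eq 1 b 1 (-a) ?_ ?_ ?_ ?_
      · have := d.ne_zero
        intro h
        exact this (by linear_combination hab - h)
      · linear_combination -hab
      · push_cast
        rw [hab]
        ring
      · ring
    calc diag d * ((1 + 1) * ((2 ^ m : ℕ) : FormClass F))
        = diag d * (((2 ^ m : ℕ) : FormClass F)
          + diag a * (diag b * ((2 ^ m : ℕ) : FormClass F))) := by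
          rw [hB, hA]
          ring
      _ = (diag d + diag (d * (a * b))) * ((2 ^ m : ℕ) : FormClass F) := by
          rw [← diag_mul_diag, ← diag_mul_diag]
          ring
      _ = (1 + 1) * ((2 ^ m : ℕ) : FormClass F) := by
          rw [← h1, add_mul, hA, hB]
          ring

theorem IsSumSqs.mul_two_pow {m : ℕ} {c d : Fˣ} (hc : IsSumSqs (2 ^ m) (c : F))
    (hd : IsSumSqs (2 ^ m) (d : F)) : IsSumSqs (2 ^ m) ((c * d : Fˣ) : F) := by
  have h := diag_mul_two_pow m c hc
  rw [← FormClass.mk_sumSquares _ (FormClass.nondegenerate_sumSquares _)] at h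
  obtain ⟨e⟩ := FormClass.mk_eq_mk.1 ((FormClass.mk_mul_mk _ _ _ _).symm.trans h)
  obtain ⟨x, hx⟩ := hd
  refine ⟨e (1 ⊗ₜ x), ?_⟩
  have h' := e.map_app (1 ⊗ₜ x)
  simp only [QuadraticMap.weightedSumSquares_apply, Pi.one_apply, one_smul,
    QuadraticForm.tensorDistrib_tmul] at h'
  simp only [sq, h']
  simp [hx, sq, mul_comm]

variable (F) in
/-- The group `D_F(2 ^ m)` of all non-zero sums of `2 ^ m` squares in `F`. -/
def sumsOfSquares (m : ℕ) : Subgroup Fˣ where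
  carrier := {d | IsSumSqs (2 ^ m) (d : F)}
  one_mem' := ⟨Pi.single ⟨0, by positivity⟩ 1, by simp [Pi.single_apply]⟩
  mul_mem' := fun hc hd => hc.mul_two_pow hd
  inv_mem' := by
    rintro d ⟨x, hx⟩
    refine ⟨fun i => (d : F)⁻¹ * x i, ?_⟩
    simp only [mul_pow, ← Finset.mul_sum, ← hx]
    simp [sq]

variable (F) in
/-- The group `± D_F(2 ^ m)`. -/
def signedSumsOfSquares (m : ℕ) : Subgroup Fˣ where
  carrier := {d | d ∈ sumsOfSquares F m ∨ -d ∈ sumsOfSquares F m}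
  one_mem' := .inl (one_mem _)
  mul_mem' := by
    rintro c d (hc | hc) (hd | hd)
    · exact .inl (mul_mem hc hd)
    · exact .inr (by simpa using mul_mem hc hd)
    · exact .inr (by simpa using mul_mem hc hd)
    · exact .inl (by simpa using mul_mem hc hd)
  inv_mem' := by
    rintro d (hd | hd)
    · exact .inl (inv_mem hd)
    · exact .inr (by simpa using inv_mem hd)

end SumsOfSquares

section SquareClasses

variable (F : Type u) [Field F]

/-- The square class group `F* / F*²`, written additively. -/
def SquareClass : Type u := Additive (Fˣ ⧸ Subgroup.square Fˣ)

instance : AddCommGroup (SquareClass F) :=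
  inferInstanceAs (AddCommGroup (Additive (Fˣ ⧸ Subgroup.square Fˣ)))

/-- `F* / F*²` as a vector space over the field with two elements. -/
instance : Module (ZMod 2) (SquareClass F) :=
  AddCommGroup.zmodModule fun x => by
    obtain ⟨a, ha⟩ := QuotientGroup.mk_surjective (s := Subgroup.square Fˣ) x.toMul
    have h : x.toMul * x.toMul = 1 := by
      rw [← ha, ← QuotientGroup.mk_mul, QuotientGroup.eq_one_iff]
      exact ⟨a, rfl⟩
    rw [two_nsmul]
    exact h

variable {F} [Invertible (2 : F)]

variable (F) in
/-- The subspace `± D_F(2 ^ m) / F*²` of the space of square classes. -/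
def signedSumsSubspace (m : ℕ) : Submodule (ZMod 2) (SquareClass F) :=
  AddSubgroup.toZModSubmodule 2 (M := SquareClass F) (Subgroup.toAddSubgroup
    ((signedSumsOfSquares F m).map (QuotientGroup.mk' (Subgroup.square Fˣ))))

/-- `A` is a basis of the subspace `W`: it is linearly independent and spans `W`. -/
def IsBasisOf (A : Set (SquareClass F)) (W : Submodule (ZMod 2) (SquareClass F)) : Prop :=
  LinearIndepOn (ZMod 2) id A ∧ Submodule.span (ZMod 2) A = W

/-- `B` is a basis of `F* / F*²` obtained as follows from an increasing sequence of bases `A m`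
of the subspaces `± D_F(2 ^ m) / F*²`: it extends the union of the `A m`.
Then `B \ A m` is identified with a basis of `F* / ± D_F(2 ^ m)`. -/
structure IsAdaptedBasis (A : ℕ → Set (SquareClass F)) (B : Set (SquareClass F)) : Prop where
  isBasisOf (m : ℕ) : IsBasisOf (A m) (signedSumsSubspace F m)
  subset_succ (m : ℕ) : A m ⊆ A (m + 1)
  iUnion_subset : ⋃ m, A m ⊆ B
  isBasis : IsBasisOf B ⊤

/-- The isometry class of the one-dimensional form `⟨u⟩` for a square class `u`. -/
noncomputable def SquareClass.diag : SquareClass F → FormClass F :=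
  Quotient.lift (s := QuotientGroup.leftRel (Subgroup.square Fˣ)) FormClass.diag
    fun a b h => by
      obtain ⟨c, hc⟩ := QuotientGroup.leftRel_apply.1 h
      rw [← FormClass.diag_mul_sq a c, ← hc, mul_inv_cancel_left]

/-- The Pfister form `⟨⟨u₁, …, uₙ⟩⟩ = ⟨1, u₁⟩ ⊗ ⋯ ⊗ ⟨1, uₙ⟩`. -/
noncomputable def pfister (s : Multiset (SquareClass F)) : FormClass F :=
  (s.map fun u => 1 + u.diag).prod

/-- The Pfister form `π_{U,k} = ⟨⟨1, …, 1, u₁, …, u_r⟩⟩` with `k` slots that are `1` (the neutral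
element of the square class group) followed by the elements `u₁, …, u_r` of `U`. -/
noncomputable def pfisterOf (U : Finset (SquareClass F)) (k : ℕ) : FormClass F :=
  pfister (Multiset.replicate k 0 + U.val)

end SquareClasses

section WittRing

variable (F : Type u) [Field F] [Invertible (2 : F)]

open FormClass

/-- Witt equivalence: two forms are equivalent if they become isometric after adding
hyperbolic planes to both of them. -/
def wittCon : RingCon (FormClass F) where
  r p q := ∃ k l : ℕ, p + k • hyperbolicPlane = q + l • hyperbolicPlane
  iseqv :=
    { refl := fun _ => ⟨0, 0, rfl⟩
      symm := fun ⟨k, l, h⟩ => ⟨l, k, h.symm⟩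
      trans := by
        rintro p q r ⟨k, l, h⟩ ⟨k', l', h'⟩
        refine ⟨k + k', l' + l, ?_⟩
        rw [add_smul, ← add_assoc, h, add_right_comm, h', add_smul, add_assoc] }
  add' := by
    rintro p q p' q' ⟨k, l, h⟩ ⟨k', l', h'⟩
    refine ⟨k + k', l + l', ?_⟩
    rw [add_smul, add_smul, add_add_add_comm, h, h', add_add_add_comm]
  mul' := by
    rintro p q p' q' ⟨k, l, h⟩ ⟨k', l', h'⟩
    have key : ∀ (x y : FormClass F) (i j : ℕ), ∃ n : ℕ,
        (x + i • hyperbolicPlane) * (y + j • hyperbolicPlane) = x * y + n • hyperbolicPlane := by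
      intro x y i j
      refine ⟨j * dim x + i * dim y + i * j * dim (hyperbolicPlane : FormClass F), ?_⟩
      have e1 : x * hyperbolicPlane = (dim x : FormClass F) * hyperbolicPlane := by
        rw [mul_hyperbolicPlane, nsmul_eq_mul]
      have e2 : y * hyperbolicPlane = (dim y : FormClass F) * hyperbolicPlane := by
        rw [mul_hyperbolicPlane, nsmul_eq_mul]
      have e3 : (hyperbolicPlane : FormClass F) * hyperbolicPlane
          = (dim (hyperbolicPlane : FormClass F) : FormClass F) * hyperbolicPlane := by
        rw [mul_hyperbolicPlane, nsmul_eq_mul]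
      simp only [nsmul_eq_mul]
      push_cast
      calc (x + (i : FormClass F) * hyperbolicPlane) * (y + (j : FormClass F) * hyperbolicPlane)
          = x * y + (j : FormClass F) * (x * hyperbolicPlane)
            + (i : FormClass F) * (y * hyperbolicPlane)
            + (i : FormClass F) * (j : FormClass F) * (hyperbolicPlane * hyperbolicPlane) := by ring
        _ = _ := by
          rw [e1, e2, e3]
          ring
    obtain ⟨n, hn⟩ := key p p' k k'
    obtain ⟨n', hn'⟩ := key q q' l l'
    exact ⟨n, n', by rw [← hn, ← hn', h, h']⟩

/-- The Witt ring `W(F)`: isometry classes of forms up to Witt equivalence. -/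
def WittRing : Type u := (wittCon F).Quotient

namespace WittRing

noncomputable instance : CommSemiring (WittRing F) :=
  inferInstanceAs (CommSemiring (wittCon F).Quotient)

variable {F}

/-- The Witt class of an isometry class of forms. -/
noncomputable def wittClass : FormClass F →+* WittRing F := (wittCon F).mk'

theorem wittClass_surjective : Function.Surjective (wittClass (F := F)) :=
  (wittCon F).mk'_surjective

theorem wittClass_eq_iff {p q : FormClass F} : wittClass p = wittClass q ↔
    ∃ k l : ℕ, p + k • hyperbolicPlane = q + l • hyperbolicPlane :=
  (wittCon F).eq

theorem wittClass_hyperbolicPlane : wittClass (hyperbolicPlane : FormClass F) = 0 := by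
  rw [← map_zero wittClass, wittClass_eq_iff]
  exact ⟨0, 1, by simp⟩

/-- The negative of a Witt class is its multiple by `⟨-1⟩`. -/
noncomputable instance : Neg (WittRing F) where
  neg w := wittClass (diag (-1)) * w

noncomputable instance : CommRing (WittRing F) where
  zsmul := zsmulRec
  neg_add_cancel w := by
    change wittClass (diag (-1)) * w + w = 0
    have h := wittClass_hyperbolicPlane (F := F)
    rw [hyperbolicPlane, map_add, map_one] at h
    calc wittClass (diag (-1)) * w + w = (1 + wittClass (diag (-1))) * w := by ring
      _ = 0 := by rw [h, zero_mul]

variable (F) in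
/-- The fundamental ideal `IF` of all Witt classes of even-dimensional forms. -/
noncomputable def fundamentalIdeal : Ideal (WittRing F) where
  carrier := {w | ∃ q : FormClass F, Even (dim q) ∧ wittClass q = w}
  zero_mem' := ⟨0, by simp, map_zero _⟩
  add_mem' := by
    rintro _ _ ⟨p, hp, rfl⟩ ⟨q, hq, rfl⟩
    exact ⟨p + q, by rw [map_add]; exact hp.add hq, map_add _ _ _⟩
  smul_mem' := by
    rintro w _ ⟨q, hq, rfl⟩
    obtain ⟨p, rfl⟩ := wittClass_surjective w
    exact ⟨p * q, by rw [map_mul]; exact hq.mul_left _, map_mul _ _ _⟩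

end WittRing

end WittRing

end QForm

open QForm

/-! In the Witt ring $\langle\langle 1\rangle\rangle=2$, and $\langle uv\rangle=\langle
u\rangle\langle v\rangle$ makes $u\mapsto\langle\langle u\rangle\rangle-2$ additive modulo $I^2$
(`onePfister_add`). Since $\mathcal B$ spans the square classes, $I$ is generated modulo $I^2$ by
$2$ and the $\langle\langle b\rangle\rangle$ with $b\in\mathcal B$. Taking products, and using
$\langle\langle u\rangle\rangle^2=2\langle\langle u\rangle\rangle$ to trade a repeated slot for a
slot $1$, one finds that $I^n$ is generated additively modulo $I^{n+1}$ by the $\pi_{U,k}$ with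
$U\subseteq\mathcal B$ and $k+|U|=n$ (`pow_le_pfisterSubgroup`).

The form $2^k\times\langle 1\rangle$ is round, so for $u\in\pm D_F(2^k)$ the product
$2^k\langle\langle u\rangle\rangle$ is $2^{k+1}$ or $0$ (`two_pow_mul_onePfister`). A slot in
$\mathcal A_k$ therefore either becomes a further $1$ or kills the form. Repeating this shrinks $U$
until it avoids $\mathcal A_k$ for the current $k$ (`pfisterSubgroup_le`).

Finally $2\in I$ sends each $n$-fold generator into $I^{n+1}$, so integer coefficients matter only
modulo $2$ and finite subset sums suffice (`exists_finset_sub_sum_mem`). -/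

/-! ### Subset sums modulo a subgroup. -/

/-- In an additive group modulo a subgroup `J`, elements generated by a family whose doubles lie in
`J` are congruent to sums over finite subfamilies. -/
theorem exists_finset_sub_sum_mem {ι M : Type*} [AddCommGroup M] (J : AddSubgroup M) (x : ι → M)
    (S : Set ι) (h2 : ∀ i ∈ S, x i + x i ∈ J) {y : M} (hy : y ∈ AddSubgroup.closure (x '' S) ⊔ J) :
    ∃ C : Finset ι, (C : Set ι) ⊆ S ∧ y - ∑ i ∈ C, x i ∈ J := by
  classical
  obtain ⟨a, ha, b, hb, rfl⟩ := AddSubgroup.mem_sup.1 hy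
  suffices h : ∃ C : Finset ι, (C : Set ι) ⊆ S ∧ a - ∑ i ∈ C, x i ∈ J by
    obtain ⟨C, hC, h⟩ := h
    exact ⟨C, hC, by rw [add_sub_right_comm]; exact J.add_mem h hb⟩
  clear hy
  induction ha using AddSubgroup.closure_induction with
  | mem a ha =>
    obtain ⟨i, hi, rfl⟩ := ha
    exact ⟨{i}, by simpa using hi, by simp⟩
  | zero => exact ⟨∅, by simp, by simp⟩
  | add a c _ _ iha ihc =>
    obtain ⟨C, hC, h⟩ := iha
    obtain ⟨D, hD, h'⟩ := ihc
    -- The symmetric difference works: indices common to `C` and `D` are counted twice, and doubles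
    -- lie in `J`.
    refine ⟨(C ∪ D) \ (C ∩ D), fun i hi => ?_, ?_⟩
    · simp only [Finset.coe_sdiff, Finset.coe_union, Set.mem_sdiff] at hi
      exact hi.1.elim (fun h => hC h) (fun h => hD h)
    · have e1 := Finset.sum_sdiff (f := x)
        (Finset.inter_subset_left.trans Finset.subset_union_left : C ∩ D ⊆ C ∪ D)
      have e2 := Finset.sum_union_inter (s₁ := C) (s₂ := D) (f := x)
      have h3 : ∑ i ∈ C ∩ D, x i + ∑ i ∈ C ∩ D, x i ∈ J := by
        rw [← Finset.sum_add_distrib]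
        exact J.sum_mem fun i hi => h2 i (hC (Finset.mem_inter.1 hi).1)
      have e3 : a + c - ∑ i ∈ (C ∪ D) \ (C ∩ D), x i =
          (a - ∑ i ∈ C, x i) + (c - ∑ i ∈ D, x i) +
            (∑ i ∈ C ∩ D, x i + ∑ i ∈ C ∩ D, x i) := by
        rw [eq_sub_of_add_eq e1, eq_sub_of_add_eq e2]
        abel
      rw [e3]
      exact J.add_mem (J.add_mem h h') h3
  | neg a _ ih =>
    obtain ⟨C, hC, h⟩ := ih
    -- Modulo `J` each term equals its own negative, so `C` serves for `-a` as well.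
    refine ⟨C, hC, ?_⟩
    have h3 : ∑ i ∈ C, x i + ∑ i ∈ C, x i ∈ J := by
      rw [← Finset.sum_add_distrib]
      exact J.sum_mem fun i hi => h2 i (hC hi)
    have e : -a - ∑ i ∈ C, x i = -(a - ∑ i ∈ C, x i) - (∑ i ∈ C, x i + ∑ i ∈ C, x i) := by abel
    rw [e]
    exact J.sub_mem (J.neg_mem h) h3

namespace QForm

open FormClass WittRing

variable {F : Type*} [Field F] [Invertible (2 : F)]

/-! ### Square classes and one-fold Pfister forms in the Witt ring. -/

/-- The square class of a unit. -/
def SquareClass.mk (a : Fˣ) : SquareClass F := Additive.ofMul (a : Fˣ ⧸ Subgroup.square Fˣ)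

theorem SquareClass.diag_mk (a : Fˣ) : (SquareClass.mk a).diag = FormClass.diag a := rfl

omit [Invertible (2 : F)] in
theorem SquareClass.exists_rep (u : SquareClass F) : ∃ a : Fˣ, u = SquareClass.mk a := by
  obtain ⟨a, ha⟩ := QuotientGroup.mk_surjective (s := Subgroup.square Fˣ) u.toMul
  exact ⟨a, congrArg Additive.ofMul ha.symm⟩

theorem SquareClass.diag_zero : SquareClass.diag (0 : SquareClass F) = 1 :=
  (SquareClass.diag_mk 1).trans diag_one

theorem SquareClass.diag_add (u v : SquareClass F) : (u + v).diag = u.diag * v.diag := by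
  obtain ⟨a, rfl⟩ := u.exists_rep
  obtain ⟨b, rfl⟩ := v.exists_rep
  exact (diag_mul_diag a b).symm

namespace WittRing

/-- The Witt class of the binary form `⟨⟨u⟩⟩ = ⟨1, u⟩`. -/
noncomputable def onePfister (u : SquareClass F) : WittRing F := wittClass (1 + u.diag)

theorem wittClass_pfisterOf (U : Finset (SquareClass F)) (k : ℕ) :
    wittClass (pfisterOf U k) = 2 ^ k * ∏ u ∈ U, onePfister u := by
  simp only [pfisterOf, pfister, Multiset.map_add, Multiset.prod_add, Multiset.map_replicate,
    Multiset.prod_replicate, SquareClass.diag_zero, map_mul, map_pow, onePfister,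
    one_add_one_eq_two, map_multiset_prod, Multiset.map_map, map_ofNat]
  rfl

theorem onePfister_zero : onePfister (0 : SquareClass F) = 2 := by
  rw [onePfister, SquareClass.diag_zero, map_add, map_one, one_add_one_eq_two]

theorem wittClass_diag (u : SquareClass F) : wittClass u.diag = onePfister u - 1 := by
  rw [onePfister, map_add, map_one, add_sub_cancel_left]

/-- With $x=\langle u\rangle$ and $y=\langle v\rangle$ this is $xy-1=(x-1)+(y-1)+(x-1)(y-1)$. The
last product lies in $I^2$, which gives additivity modulo $I^2$ after the shift by $2$. -/
theorem onePfister_add (u v : SquareClass F) :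
    onePfister (u + v) = onePfister u + onePfister v - 2 + (onePfister u - 2) * (onePfister v - 2) := by
  have h : onePfister (u + v) = 1 + (onePfister u - 1) * (onePfister v - 1) := by
    rw [← wittClass_diag, ← wittClass_diag, ← map_mul, ← SquareClass.diag_add, wittClass_diag]
    ring
  rw [h]
  ring

/-- Every square class is its own inverse, so this is `onePfister_add` with both arguments equal. -/
theorem onePfister_mul_self (u : SquareClass F) :
    onePfister u * onePfister u = 2 * onePfister u := by
  have h : u + u = 0 := by
    rw [← two_nsmul, ← Nat.cast_smul_eq_nsmul (ZMod 2)]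
    exact zero_smul _ u
  have h' := onePfister_add u u
  rw [h, onePfister_zero] at h'
  linear_combination -h'

theorem onePfister_mem (u : SquareClass F) : onePfister u ∈ fundamentalIdeal F := by
  obtain ⟨a, rfl⟩ := u.exists_rep
  refine ⟨_, ?_, rfl⟩
  have h : dim (FormClass.diag a) = 1 := Module.finrank_self F
  rw [SquareClass.diag_mk, map_add, map_one, h]
  exact even_two

theorem two_mem : (2 : WittRing F) ∈ fundamentalIdeal F :=
  onePfister_zero (F := F) ▸ onePfister_mem 0

theorem two_pow_mul_prod_mem (U : Finset (SquareClass F)) (k : ℕ) :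
    2 ^ k * ∏ u ∈ U, onePfister u ∈ fundamentalIdeal F ^ (k + U.card) := by
  rw [pow_add]
  refine Ideal.mul_mem_mul (Ideal.pow_mem_pow two_mem k) ?_
  rw [← Finset.prod_const]
  exact Ideal.prod_mem_prod fun u _ => onePfister_mem u

/-- Roundness of $2^k\times\langle 1\rangle$ gives $2^k\langle c\rangle=2^k$ for $c\in D_F(2^k)$.
The two alternatives correspond to the sign in $\pm D_F(2^k)$. -/
theorem two_pow_mul_onePfister {k : ℕ} {u : SquareClass F} (hu : u ∈ signedSumsSubspace F k) :
    2 ^ k * onePfister u = 2 ^ (k + 1) ∨ 2 ^ k * onePfister u = 0 := by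
  obtain ⟨d, hd, rfl⟩ : ∃ d ∈ signedSumsOfSquares F k, u = SquareClass.mk d := by
    obtain ⟨d, hd, h⟩ := hu
    exact ⟨d, hd, congrArg Additive.ofMul h.symm⟩
  have key : ∀ c ∈ sumsOfSquares F k, 2 ^ k * wittClass (FormClass.diag c) = 2 ^ k := by
    intro c hc
    have h := congrArg wittClass (diag_mul_two_pow k c hc)
    rw [map_mul, map_natCast, Nat.cast_pow, Nat.cast_ofNat] at h
    rwa [mul_comm]
  rw [onePfister, SquareClass.diag_mk, map_add, map_one]
  rcases hd with hd | hd
  · left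
    rw [mul_add, key d hd]
    ring
  · right
    -- Here $-d\in D_F(2^k)$, and $\langle -d\rangle=-\langle d\rangle$ because the hyperbolic plane
    -- vanishes.
    have h := key _ hd
    have h1 : FormClass.diag (-d) = FormClass.diag (-1) * FormClass.diag d := by
      rw [diag_mul_diag, neg_one_mul]
    have h2 := wittClass_hyperbolicPlane (F := F)
    rw [hyperbolicPlane, map_add, map_one] at h2
    rw [h1, map_mul] at h
    linear_combination -h + 2 ^ k * wittClass (FormClass.diag d) * h2

/-! ### Generators of $I^n$ modulo $I^{n+1}$ with slots in a spanning set. -/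

/-- The subgroup generated by `I ^ (n + 1)` and by the forms `⟨⟨1, …, 1, u₁, …, uᵣ⟩⟩` with `n` slots
and distinct `uᵢ` in `B`. -/
noncomputable def pfisterSubgroup (B : Set (SquareClass F)) (n : ℕ) : AddSubgroup (WittRing F) :=
  AddSubgroup.closure {x | ∃ (k : ℕ) (U : Finset (SquareClass F)), (U : Set _) ⊆ B ∧
    k + U.card = n ∧ x = 2 ^ k * ∏ u ∈ U, onePfister u} ⊔
    (fundamentalIdeal F ^ (n + 1)).toAddSubgroup

variable {B : Set (SquareClass F)}

theorem two_pow_mul_prod_mem_pfisterSubgroup {n k : ℕ} {U : Finset (SquareClass F)}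
    (hU : (U : Set _) ⊆ B) (h : k + U.card = n) :
    2 ^ k * ∏ u ∈ U, onePfister u ∈ pfisterSubgroup B n :=
  AddSubgroup.mem_sup_left (AddSubgroup.subset_closure ⟨k, U, hU, h, rfl⟩)

theorem mem_pfisterSubgroup_of_mem_pow {n : ℕ} {x : WittRing F}
    (hx : x ∈ fundamentalIdeal F ^ (n + 1)) : x ∈ pfisterSubgroup B n :=
  AddSubgroup.mem_sup_right hx

theorem two_mem_pfisterSubgroup : (2 : WittRing F) ∈ pfisterSubgroup B 1 := by
  simpa using two_pow_mul_prod_mem_pfisterSubgroup (B := B) (n := 1) (k := 1) (U := ∅)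
    (by simp) (by simp)

/-- Induction over the span of `B`: addition of square classes costs only the generator $2$ (no slot
from `B`, one slot $1$) and an element of $I^2$. -/
theorem onePfister_mem_pfisterSubgroup (hB : Submodule.span (ZMod 2) B = ⊤) (u : SquareClass F) :
    onePfister u ∈ pfisterSubgroup B 1 := by
  have hu : u ∈ Submodule.span (ZMod 2) B := hB ▸ Submodule.mem_top
  induction hu using Submodule.span_induction with
  | mem u hu =>
    simpa using two_pow_mul_prod_mem_pfisterSubgroup (B := B) (n := 1) (k := 0) (U := {u})
      (by simpa using hu) (by simp)
  | zero =>
    rw [onePfister_zero]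
    exact two_mem_pfisterSubgroup
  | add u v _ _ hu hv =>
    rw [onePfister_add]
    have h : ∀ w : SquareClass F, onePfister w - 2 ∈ fundamentalIdeal F :=
      fun w => sub_mem (onePfister_mem w) two_mem
    refine add_mem (sub_mem (add_mem hu hv) two_mem_pfisterSubgroup)
      (mem_pfisterSubgroup_of_mem_pow ?_)
    rw [pow_two]
    exact Ideal.mul_mem_mul (h u) (h v)
  | smul c u _ hu =>
    rcases (by decide : ∀ c : ZMod 2, c = 0 ∨ c = 1) c with rfl | rfl
    · rw [zero_smul, onePfister_zero]
      exact two_mem_pfisterSubgroup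
    · rwa [one_smul]

/-- A form is congruent to its dimension, modulo binary forms `⟨⟨u⟩⟩`. -/
theorem wittClass_sub_dim_mem (hB : Submodule.span (ZMod 2) B = ⊤) (q : FormClass F) :
    wittClass q - dim q ∈ pfisterSubgroup B 1 := by
  obtain ⟨s, rfl⟩ := exists_sum_diag q
  induction s using Multiset.induction_on with
  | empty => simp
  | cons a s ih =>
    have h1 : dim (FormClass.diag a) = 1 := Module.finrank_self F
    -- A diagonal entry contributes $\langle a\rangle-1=\langle\langle a\rangle\rangle-2$.
    have h2 := sub_mem (onePfister_mem_pfisterSubgroup hB (SquareClass.mk a)) two_mem_pfisterSubgroup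
    rw [onePfister, map_add, map_one, SquareClass.diag_mk] at h2
    convert add_mem h2 ih using 1
    simp only [Multiset.map_cons, Multiset.sum_cons, map_add, h1, Nat.cast_add, Nat.cast_one]
    ring

/-- The dimension is even, hence a multiple of the generator $2$. -/
theorem fundamentalIdeal_le_pfisterSubgroup (hB : Submodule.span (ZMod 2) B = ⊤) {x : WittRing F}
    (hx : x ∈ fundamentalIdeal F) : x ∈ pfisterSubgroup B 1 := by
  obtain ⟨q, ⟨m, hm⟩, rfl⟩ := hx
  have h := add_mem (wittClass_sub_dim_mem hB q) (nsmul_mem two_mem_pfisterSubgroup m)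
  rw [hm] at h
  convert h using 1
  rw [nsmul_eq_mul]
  push_cast
  ring

/-- Each slot common to `U` and `V` occurs squared and yields a factor $2$. It moves to the slots
$1$, so the total number of slots is preserved. -/
theorem two_pow_mul_prod_mul (U V : Finset (SquareClass F)) (k l : ℕ) :
    ∃ (j : ℕ) (W : Finset (SquareClass F)), (W : Set (SquareClass F)) ⊆ (U ∪ V : Set (SquareClass F)) ∧
      j + W.card = k + U.card + (l + V.card) ∧
      (2 ^ k * ∏ u ∈ U, onePfister u) * (2 ^ l * ∏ u ∈ V, onePfister u) =
        2 ^ j * ∏ u ∈ W, onePfister u := by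
  classical
  refine ⟨k + l + (U ∩ V).card, U ∪ V, by simp, ?_, ?_⟩
  · have := Finset.card_union_add_card_inter U V
    omega
  · have h1 := Finset.prod_union_inter (s₁ := U) (s₂ := V) (f := onePfister)
    -- Splitting off $U\cap V$ from $U\cup V$ exhibits the square of the product over $U\cap V$, to
    -- which `h3` applies.
    have h2 := Finset.prod_sdiff (f := onePfister)
      (Finset.inter_subset_left.trans Finset.subset_union_left : U ∩ V ⊆ U ∪ V)
    have h3 : (∏ u ∈ U ∩ V, onePfister u) * (∏ u ∈ U ∩ V, onePfister u) =
        2 ^ (U ∩ V).card * ∏ u ∈ U ∩ V, onePfister u := by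
      rw [← Finset.prod_mul_distrib, ← Finset.prod_const, ← Finset.prod_mul_distrib]
      exact Finset.prod_congr rfl fun u _ => onePfister_mul_self u
    rw [← h2] at h1
    rw [← h2, pow_add, pow_add]
    linear_combination (-2 ^ k * 2 ^ l) * h1 +
      2 ^ k * 2 ^ l * (∏ u ∈ (U ∪ V) \ (U ∩ V), onePfister u) * h3

theorem pfisterSubgroup_le_pow {n : ℕ} {x : WittRing F} (hx : x ∈ pfisterSubgroup B n) :
    x ∈ fundamentalIdeal F ^ n := by
  have h : pfisterSubgroup B n ≤ (fundamentalIdeal F ^ n).toAddSubgroup := by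
    refine sup_le ((AddSubgroup.closure_le _).2 ?_) (Ideal.pow_le_pow_right n.le_succ)
    rintro _ ⟨k, U, -, rfl, rfl⟩
    exact two_pow_mul_prod_mem U k
  exact h hx

/-- Generators multiply to generators by `two_pow_mul_prod_mul`. The error terms lie in $I^m
I^{n+1}$ and $I^{m+1}I^n$, both contained in $I^{m+n+1}$. -/
theorem mul_mem_pfisterSubgroup {m n : ℕ} {x y : WittRing F} (hx : x ∈ pfisterSubgroup B m)
    (hy : y ∈ pfisterSubgroup B n) : x * y ∈ pfisterSubgroup B (m + n) := by
  have hy' := pfisterSubgroup_le_pow hy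
  obtain ⟨a, ha, b, hb, rfl⟩ := AddSubgroup.mem_sup.1 hx
  clear hx
  rw [add_mul]
  refine add_mem ?_ (mem_pfisterSubgroup_of_mem_pow ?_)
  · obtain ⟨c, hc, d, hd, rfl⟩ := AddSubgroup.mem_sup.1 hy
    clear hy hy'
    rw [mul_add]
    refine add_mem ?_ (mem_pfisterSubgroup_of_mem_pow ?_)
    · clear hd
      induction ha using AddSubgroup.closure_induction with
      | mem a ha =>
        obtain ⟨k, U, hU, rfl, rfl⟩ := ha
        induction hc using AddSubgroup.closure_induction with
        | mem c hc =>
          obtain ⟨l, V, hV, rfl, rfl⟩ := hc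
          obtain ⟨j, W, hW, hj, h⟩ := two_pow_mul_prod_mul U V k l
          rw [h]
          exact two_pow_mul_prod_mem_pfisterSubgroup (hW.trans (Set.union_subset hU hV)) hj
        | zero => simp
        | add c d _ _ h h' =>
          rw [mul_add]
          exact add_mem h h'
        | neg c _ h =>
          rw [mul_neg]
          exact neg_mem h
      | zero => simp
      | add a b _ _ h h' =>
        rw [add_mul]
        exact add_mem h h'
      | neg a _ h =>
        rw [neg_mul]
        exact neg_mem h
    · rw [add_assoc, pow_add]
      exact Ideal.mul_mem_mul (pfisterSubgroup_le_pow (B := B) (AddSubgroup.mem_sup_left ha)) hd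
  · rw [add_right_comm, pow_add]
    exact Ideal.mul_mem_mul hb hy'

theorem pow_le_pfisterSubgroup (hB : Submodule.span (ZMod 2) B = ⊤) (n : ℕ) {x : WittRing F}
    (hx : x ∈ fundamentalIdeal F ^ n) : x ∈ pfisterSubgroup B n := by
  induction n generalizing x with
  | zero =>
    obtain ⟨q, rfl⟩ := wittClass_surjective x
    have h1 : (1 : WittRing F) ∈ pfisterSubgroup B 0 := by
      simpa using two_pow_mul_prod_mem_pfisterSubgroup (B := B) (n := 0) (k := 0) (U := ∅)
        (by simp) (by simp)
    -- In degree $0$ a class is its dimension times the empty product $1$, up to an element of $I$.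
    have h := add_mem (mem_pfisterSubgroup_of_mem_pow (n := 0)
      (pfisterSubgroup_le_pow (wittClass_sub_dim_mem hB q))) (nsmul_mem h1 (dim q))
    simpa using h
  | succ n ih =>
    rw [pow_succ] at hx
    induction hx using Submodule.mul_induction_on' with
    | mem_mul_mem a ha b hb =>
      exact mul_mem_pfisterSubgroup (ih ha) (fundamentalIdeal_le_pfisterSubgroup hB hb)
    | add a _ b _ ha hb => exact add_mem ha hb

/-! ### Eliminating slots that are signed sums of $2^k$ squares. -/

/-- The generators `⟨⟨1, …, 1, u₁, …, uᵣ⟩⟩` may be taken with no `uᵢ` in `A k`, where `k` is the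
number of slots `1`. -/
theorem pfisterSubgroup_le {A : ℕ → Set (SquareClass F)}
    (hA : ∀ k, A k ⊆ signedSumsSubspace F k) (n : ℕ) {G : AddSubgroup (WittRing F)}
    (hG : (fundamentalIdeal F ^ (n + 1)).toAddSubgroup ≤ G)
    (h : ∀ (k : ℕ) (U : Finset (SquareClass F)), (U : Set _) ⊆ B \ A k → k + U.card = n →
      2 ^ k * ∏ u ∈ U, onePfister u ∈ G) : pfisterSubgroup B n ≤ G := by
  classical
  refine sup_le ((AddSubgroup.closure_le _).2 ?_) hG
  rintro _ ⟨k, U, hU, hk, rfl⟩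
  -- `k` must vary: absorbing a slot raises it to `k + 1`, and the remaining slots are then tested
  -- against `A (k + 1)`.
  induction hr : U.card generalizing k U with
  | zero =>
    obtain rfl := Finset.card_eq_zero.1 hr
    exact h k ∅ (by simp) hk
  | succ r ih =>
    by_cases hUA : ∃ u ∈ U, u ∈ A k
    · obtain ⟨u, hu, huA⟩ := hUA
      rw [← Finset.mul_prod_erase U _ hu, ← mul_assoc]
      have hc := Finset.card_erase_of_mem hu
      rcases two_pow_mul_onePfister (hA k huA) with e | e
      · rw [e]
        exact ih (k + 1) (U.erase u)
          ((Finset.coe_subset.2 (Finset.erase_subset u U)).trans hU) (by omega) (by omega)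
      · rw [e, zero_mul]
        exact G.zero_mem
    · push Not at hUA
      exact h k U (fun u hu => ⟨hU hu, hUA u hu⟩) hk

end WittRing

end QForm

/-! ### Representation by an adapted basis. -/

open QForm
theorem mainTheorem6 {F : Type*} [Field F] [Invertible (2 : F)]
    (A : ℕ → Set (SquareClass F)) (B : Set (SquareClass F)) (hB : IsAdaptedBasis A B)
    (n : ℕ) (φ : WittRing F) (hφ : φ ∈ WittRing.fundamentalIdeal F ^ n) :
    ∃ C : ℕ → Finset (Finset (SquareClass F)),
      (∀ m ≤ n, ∀ U ∈ C m, U.card = m ∧ (U : Set (SquareClass F)) ⊆ B \ A (n - m)) ∧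
      φ - ∑ m ∈ Finset.range (n + 1), ∑ U ∈ C m, WittRing.wittClass (pfisterOf U (n - m)) ∈
        WittRing.fundamentalIdeal F ^ (n + 1) := by
  classical
  -- A generator is indexed by `U` alone, since the number of slots $1$ is forced to be $n-|U|$. The
  -- bound $|U|\le n$ makes the truncated subtraction exact.
  let S : Set (Finset (SquareClass F)) :=
    {U | U.card ≤ n ∧ (U : Set (SquareClass F)) ⊆ B \ A (n - U.card)}
  let x : Finset (SquareClass F) → WittRing F := fun U =>
    WittRing.wittClass (pfisterOf U (n - U.card))
  have hx : φ ∈ AddSubgroup.closure (x '' S) ⊔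
      (WittRing.fundamentalIdeal F ^ (n + 1)).toAddSubgroup := by
    have hA : ∀ k, A k ⊆ signedSumsSubspace F k := fun k => by
      rw [← (hB.isBasisOf k).2]
      exact Submodule.subset_span
    refine WittRing.pfisterSubgroup_le (B := B) hA n le_sup_right (fun k U hU hk => ?_)
      (WittRing.pow_le_pfisterSubgroup hB.isBasis.2 n hφ)
    have e : n - U.card = k := by omega
    refine AddSubgroup.mem_sup_left (AddSubgroup.subset_closure ⟨U, ⟨by omega, by rwa [e]⟩, ?_⟩)
    simp only [x, e, WittRing.wittClass_pfisterOf]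
  -- The doubling hypothesis holds because each generator lies in $I^n$ and $2\in I$.
  obtain ⟨C, hC, h⟩ := exists_finset_sub_sum_mem _ x S (fun U hU => by
    have e : n - U.card + U.card = n := Nat.sub_add_cancel hU.1
    have h := WittRing.two_pow_mul_prod_mem U (n - U.card)
    rw [← WittRing.wittClass_pfisterOf, e] at h
    rw [← mul_two]
    change _ ∈ WittRing.fundamentalIdeal F ^ (n + 1)
    rw [pow_succ]
    exact Ideal.mul_mem_mul h WittRing.two_mem) hx
  -- The sets $C_m$ sort the single family `C` by cardinality. As $|U|\le n$ on `C`, the range $m\le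
  -- n$ exhausts it.
  refine ⟨fun m => C.filter fun U => U.card = m, fun m _ U hU => ?_, ?_⟩
  · obtain ⟨hUC, rfl⟩ := Finset.mem_filter.1 hU
    exact ⟨rfl, (hC hUC).2⟩
  · have e : ∑ m ∈ Finset.range (n + 1), ∑ U ∈ C with U.card = m,
        WittRing.wittClass (pfisterOf U (n - m)) = ∑ U ∈ C, x U := by
      rw [← Finset.sum_fiberwise_of_maps_to (s := C) (t := Finset.range (n + 1))
        (g := Finset.card) (fun U hU => Finset.mem_range_succ_iff.2 (hC hU).1)]
      refine Finset.sum_congr rfl fun m _ => Finset.sum_congr rfl fun U hU => ?_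
      rw [← (Finset.mem_filter.1 hU).2]
    rw [e]
    exact h
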